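/- Let $n\ge 2$, let $\Omega\subset\mathbb{R}^n$ be a domain, and let $E\subset\Omega$ be closed in $\Omega$ with $\mathcal{H}^{n-1}(E)<+\infty$, where $\mathcal{H}^{n-1}$ is $(n-1)$-dimensional Hausdorff measure. For $1\le j\le n$ write points of $\mathbb{R}^n$ as $x=(x_j,X_j)$, where $X_j\in\mathbb{R}^{n-1}$ consists of the coordinates of $x$ other than $x_j$, and for $A\subset\mathbb{R}^n$ put $A(X_j)=\{x_j\in\mathbb{R}:(x_j,X_j)\in A\}$. Let $u:\Omega\setminus E\to\mathbb{R}$ be harmonic and such that the following conditions hold. (i) $u\in\mathcal{L}^1_{\mathrm{loc}}(\Omega)$. (ii) For each $j$, $1\le j\le n$, $\dfrac{\partial^2u}{\partial x_j^2}\in\mathcal{L}^1_{\mathrm{loc}}(\Omega)$. (iii) For each $j$, $1\le j\le n$, and for $\mathcal{H}^{n-1}$-almost all $X_j\in\mathbb{R}^{n-1}$ such that $E(X_j)$ is finite, the following holds: for each $x_j^0\in E(X_j)$ there exist sequences $x_{j,l}^{0,1},x_{j,l}^{0,2}\in(\Omega\setminus E)(X_j)$, $l=1,2,\dots$, such that $x_{j,l}^{0,1}\nearrow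 x_j^0$ and $x_{j,l}^{0,2}\searrow x_j^0$ as $l\to+\infty$, and (a) $\displaystyle\lim_{l\to+\infty}u(x_{j,l}^{0,1},X_j)=\lim_{l\to+\infty}u(x_{j,l}^{0,2},X_j)\in\mathbb{R}$, (b) $\displaystyle-\infty<\liminf_{l\to+\infty}\frac{\partial u}{\partial x_j}(x_{j,l}^{0,1},X_j)=\limsup_{l\to+\infty}\frac{\partial u}{\partial x_j}(x_{j,l}^{0,2},X_j)<+\infty$. Then $u$ has a unique harmonic extension to $\Omega$. -/

import Mathlib

open Set Filter Topology MeasureTheory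

namespace HarmonicExtension

noncomputable section

/-- The point `x = (x_j, X_j)` of `ℝⁿ` whose `j`-th coordinate is `t` and whose remaining
coordinates are given by `X`. -/
def coordPoint {n : ℕ} (j : Fin n) (t : ℝ) (X : EuclideanSpace ℝ {i : Fin n // i ≠ j}) :
    EuclideanSpace ℝ (Fin n) :=
  WithLp.toLp 2 fun i => if h : i = j then t else X ⟨i, h⟩

/-- The section `A(X_j) = {x_j ∈ ℝ : (x_j, X_j) ∈ A}` of `A ⊆ ℝⁿ` by the line through `X_j`
parallel to the `j`-th coordinate axis. -/
def lineSection {n : ℕ} (A : Set (EuclideanSpace ℝ (Fin n))) (j : Fin n)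
    (X : EuclideanSpace ℝ {i : Fin n // i ≠ j}) : Set ℝ :=
  {t : ℝ | coordPoint j t X ∈ A}

/-- The partial derivative `∂u/∂x_j`. -/
def partialDeriv {n : ℕ} (j : Fin n) (u : EuclideanSpace ℝ (Fin n) → ℝ) :
    EuclideanSpace ℝ (Fin n) → ℝ :=
  fun x => lineDeriv ℝ u x (EuclideanSpace.single j (1 : ℝ))

/-- The matching condition for `u` at the point `(t, X)` of `E`, in the direction `x_j`: there are
sequences in `(Ω \ E)(X)`, one increasing to `t` and one decreasing to `t`, along which `u` has the
same finite limit and along which the lower limit of `∂u/∂x_j` (from the left) and the upper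
limit of `∂u/∂x_j` (from the right), taken in the extended reals, are finite and equal. -/
def MatchesAt {n : ℕ} (Ω E : Set (EuclideanSpace ℝ (Fin n))) (u : EuclideanSpace ℝ (Fin n) → ℝ)
    (j : Fin n) (X : EuclideanSpace ℝ {i : Fin n // i ≠ j}) (t : ℝ) : Prop :=
  ∃ s₁ s₂ : ℕ → ℝ,
    (∀ l, s₁ l ∈ lineSection (Ω \ E) j X) ∧ (∀ l, s₂ l ∈ lineSection (Ω \ E) j X) ∧
    Monotone s₁ ∧ Tendsto s₁ atTop (𝓝 t) ∧ Antitone s₂ ∧ Tendsto s₂ atTop (𝓝 t) ∧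
    (∃ a : ℝ, Tendsto (fun l => u (coordPoint j (s₁ l) X)) atTop (𝓝 a) ∧
      Tendsto (fun l => u (coordPoint j (s₂ l) X)) atTop (𝓝 a)) ∧
    (∃ b : ℝ,
      liminf (fun l => ((partialDeriv j u (coordPoint j (s₁ l) X) : ℝ) : EReal)) atTop = b ∧
      limsup (fun l => ((partialDeriv j u (coordPoint j (s₂ l) X) : ℝ) : EReal)) atTop = b)

end

end HarmonicExtension

/-! The function `u` is weakly harmonic across `E`, and Weyl's lemma then removes `E`.

Almost every line parallel to an axis meets `E` in finitely many points (`ae_finite_lineSection`),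
and by Fubini `∂²u/∂x_j²` is locally integrable along it. Hence `u` and `∂u/∂x_j` have finite
one-sided limits at each exceptional point. The sequences in the matching condition only serve to
show that the two sides agree. Integrating by parts twice on the line therefore leaves no jump
terms. Integrating over the lines, summing over `j` and using that `E` is null gives `∫ u Δφ = 0`.

Only radial `φ` are needed. With `s = c² ‖y - x‖²` and `φ = profilePrimitive s`, the Laplacian of
`φ` is `2c² (n profile s + 2 s profile' s)`. Up to a power of `c` and a constant, this is the
`c`-derivative of `c ^ n * profile s`. So the average of `u` against this kernel does not depend on
the scale (`radialAverage_eq`). As `c → ∞` it tends to `profileMass n * u x` at points of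
continuity, while at fixed `c` it is smooth in `x`. The normalised average is thus a `C²` function
`U` equal to `u` off `E`. Its Laplacian is continuous and vanishes on the dense set `Ω \ E`, so it
vanishes on `Ω`. Density also gives uniqueness. -/

namespace HarmonicExtension

/-! ### One-dimensional analysis at exceptional points -/

/-- A function with integrable derivative on a bounded interval is the restriction of a function
continuous on the closed interval. -/
theorem exists_continuousOn_Icc_extension {a b : ℝ} (hab : a < b) {f f' : ℝ → ℝ}
    (hf : ∀ t ∈ Ioo a b, HasDerivAt f (f' t) t) (hi : IntegrableOn f' (Ioo a b)) :
    ∃ G : ℝ → ℝ, ContinuousOn G (Icc a b) ∧ EqOn f G (Ioo a b) := by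
  have hm : (a + b) / 2 ∈ Ioo a b := ⟨by linarith, by linarith⟩
  have hI : IntervalIntegrable f' volume a b := by
    rw [intervalIntegrable_iff_integrableOn_Ioo_of_le hab.le]; exact hi
  refine ⟨fun s => f ((a + b) / 2) + ∫ x in ((a + b) / 2)..s, f' x, ?_, ?_⟩
  · have := intervalIntegral.continuousOn_primitive_interval' (a := (a + b) / 2) hI
      (by rw [uIcc_of_le hab.le]; exact Ioo_subset_Icc_self hm)
    rw [uIcc_of_le hab.le] at this
    exact continuousOn_const.add this
  · intro s hs
    have hsub : uIcc ((a + b) / 2) s ⊆ Ioo a b := ordConnected_Ioo.uIcc_subset hm hs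
    have := intervalIntegral.integral_eq_sub_of_hasDerivAt (f := f) (f' := f')
      (a := (a + b) / 2) (b := s) (fun x hx => hf x (hsub hx))
      (hI.mono_set (by rw [uIcc_of_le hab.le]; exact hsub.trans Ioo_subset_Icc_self))
    simp only [this]; ring

/-- Two integrations: `f₁` extends continuously to the closed interval, hence is integrable, hence
`f` extends as well. -/
theorem exists_tendsto_of_integrable_second_deriv {a b : ℝ} (hab : a < b) {f f₁ f₂ : ℝ → ℝ}
    (hf : ∀ t ∈ Ioo a b, HasDerivAt f (f₁ t) t) (hf₁ : ∀ t ∈ Ioo a b, HasDerivAt f₁ (f₂ t) t)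
    (hi : IntegrableOn f₂ (Ioo a b)) :
    (∃ p p₁, Tendsto f (𝓝[>] a) (𝓝 p) ∧ Tendsto f₁ (𝓝[>] a) (𝓝 p₁)) ∧
      ∃ q q₁, Tendsto f (𝓝[<] b) (𝓝 q) ∧ Tendsto f₁ (𝓝[<] b) (𝓝 q₁) := by
  obtain ⟨G₁, hG₁, he₁⟩ := exists_continuousOn_Icc_extension hab hf₁ hi
  have hi₁ : IntegrableOn f₁ (Ioo a b) :=
    ((hG₁.integrableOn_Icc).mono_set Ioo_subset_Icc_self).congr_fun he₁.symm measurableSet_Ioo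
  obtain ⟨G, hG, he⟩ := exists_continuousOn_Icc_extension hab hf hi₁
  have left : ∀ {g H : ℝ → ℝ}, ContinuousOn H (Icc a b) → EqOn g H (Ioo a b) →
      Tendsto g (𝓝[>] a) (𝓝 (H a)) := by
    intro g H hH hg
    rw [← nhdsWithin_Ioo_eq_nhdsGT hab]
    exact ((hH a (left_mem_Icc.2 hab.le)).mono Ioo_subset_Icc_self).tendsto.congr'
      (eventually_mem_nhdsWithin.mono fun t ht => (hg ht).symm)
  have right : ∀ {g H : ℝ → ℝ}, ContinuousOn H (Icc a b) → EqOn g H (Ioo a b) →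
      Tendsto g (𝓝[<] b) (𝓝 (H b)) := by
    intro g H hH hg
    rw [← nhdsWithin_Ioo_eq_nhdsLT hab]
    exact ((hH b (right_mem_Icc.2 hab.le)).mono Ioo_subset_Icc_self).tendsto.congr'
      (eventually_mem_nhdsWithin.mono fun t ht => (hg ht).symm)
  exact ⟨⟨_, _, left hG he, left hG₁ he₁⟩, ⟨_, _, right hG he, right hG₁ he₁⟩⟩

/-- If the second derivative is integrable on a punctured neighbourhood of `t`, then the weak
sequential matching at `t` forces `f` and `f'` to have finite limits at `t`. -/
theorem exists_tendsto_punctured {δ t : ℝ} (hδ : 0 < δ) {f f₁ f₂ : ℝ → ℝ}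
    (hf : ∀ s ∈ Ioo (t - δ) (t + δ), s ≠ t → HasDerivAt f (f₁ s) s)
    (hf₁ : ∀ s ∈ Ioo (t - δ) (t + δ), s ≠ t → HasDerivAt f₁ (f₂ s) s)
    (hi : IntegrableOn f₂ (Ioo (t - δ) (t + δ)))
    {s₁ s₂ : ℕ → ℝ} (h₁ : Tendsto s₁ atTop (𝓝[<] t)) (h₂ : Tendsto s₂ atTop (𝓝[>] t))
    {a b : ℝ} (ha₁ : Tendsto (fun l => f (s₁ l)) atTop (𝓝 a))
    (ha₂ : Tendsto (fun l => f (s₂ l)) atTop (𝓝 a))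
    (hb₁ : liminf (fun l => ((f₁ (s₁ l) : ℝ) : EReal)) atTop = b)
    (hb₂ : limsup (fun l => ((f₁ (s₂ l) : ℝ) : EReal)) atTop = b) :
    Tendsto f (𝓝[≠] t) (𝓝 a) ∧ Tendsto f₁ (𝓝[≠] t) (𝓝 b) := by
  have subL : Ioo (t - δ) t ⊆ Ioo (t - δ) (t + δ) := Ioo_subset_Ioo_right (by linarith)
  have subR : Ioo t (t + δ) ⊆ Ioo (t - δ) (t + δ) := Ioo_subset_Ioo_left (by linarith)
  obtain ⟨-, q, q₁, hq, hq₁⟩ := exists_tendsto_of_integrable_second_deriv (a := t - δ) (b := t)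
    (by linarith) (fun s hs => hf s (subL hs) hs.2.ne) (fun s hs => hf₁ s (subL hs) hs.2.ne)
    (hi.mono_set subL)
  obtain ⟨⟨p, p₁, hp, hp₁⟩, -⟩ := exists_tendsto_of_integrable_second_deriv (a := t) (b := t + δ)
    (by linarith) (fun s hs => hf s (subR hs) hs.1.ne') (fun s hs => hf₁ s (subR hs) hs.1.ne')
    (hi.mono_set subR)
  -- The one-sided limits already exist, so a sequence, and even a lower or upper limit along it, is
  -- enough to identify them.
  have e1 : q = a := tendsto_nhds_unique (hq.comp h₁) ha₁
  have e2 : p = a := tendsto_nhds_unique (hp.comp h₂) ha₂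
  have e3 : q₁ = b := by
    have := ((continuous_coe_real_ereal.tendsto q₁).comp (hq₁.comp h₁)).liminf_eq
    exact_mod_cast this.symm.trans hb₁
  have e4 : p₁ = b := by
    have := ((continuous_coe_real_ereal.tendsto p₁).comp (hp₁.comp h₂)).limsup_eq
    exact_mod_cast this.symm.trans hb₂
  subst e1 e2 e3 e4
  rw [← Iio_union_Ioi, nhdsWithin_union]
  exact ⟨hq.sup hp, hq₁.sup hp₁⟩

/-- Integration by parts twice across a finite exceptional set at which `g` and `g'` have
limits. -/
theorem integral_mul_second_deriv_eq {F K O : Set ℝ} (hF : F.Finite) (hK : IsCompact K)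
    (hKO : K ⊆ O) {g g₁ g₂ φ φ₁ φ₂ : ℝ → ℝ}
    (hφ : ∀ t, HasDerivAt φ (φ₁ t) t) (hφ₁ : ∀ t, HasDerivAt φ₁ (φ₂ t) t)
    (hv : ∀ t ∉ K, φ t = 0) (hv₁ : ∀ t ∉ K, φ₁ t = 0) (hv₂ : ∀ t ∉ K, φ₂ t = 0)
    (hg : ∀ t ∈ O \ F, HasDerivAt g (g₁ t) t) (hg₁ : ∀ t ∈ O \ F, HasDerivAt g₁ (g₂ t) t)
    (hlim : ∀ t ∈ F ∩ O, ∃ a b, Tendsto g (𝓝[≠] t) (𝓝 a) ∧ Tendsto g₁ (𝓝[≠] t) (𝓝 b))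
    (hi : Integrable fun t => g t * φ₂ t) (hi₂ : Integrable fun t => g₂ t * φ t) :
    ∫ t, g t * φ₂ t = ∫ t, g₂ t * φ t := by
  set w : ℝ → ℝ := fun t => g t * φ₁ t - g₁ t * φ t with hw
  have hd : ∀ t ∉ F, HasDerivAt w (g t * φ₂ t - g₂ t * φ t) t := by
    intro t ht
    by_cases htK : t ∈ K
    · exact (((hg t ⟨hKO htK, ht⟩).mul (hφ₁ t)).sub
        ((hg₁ t ⟨hKO htK, ht⟩).mul (hφ t))).congr_deriv (by ring)
    · have : w =ᶠ[𝓝 t] fun _ => 0 := by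
        filter_upwards [hK.isClosed.isOpen_compl.mem_nhds htK] with s hs
        simp [hw, hv s hs, hv₁ s hs]
      rw [hv t htK, hv₂ t htK]
      simpa using (hasDerivAt_const t (0 : ℝ)).congr_of_eventuallyEq this
  have hdense : Dense Fᶜ := hF.countable.dense_compl ℝ
  have hopen : IsOpen Fᶜ := hF.isClosed.isOpen_compl
  -- The values of `w` on `F` carry no information, so `w` is replaced by its continuous extension
  -- from `Fᶜ`; the fundamental theorem of calculus then tolerates the finite set `F`.
  have hle : ∀ t ∈ F, 𝓝[Fᶜ] t ≤ 𝓝[≠] t := fun t ht =>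
    nhdsWithin_mono _ fun s hs h => hs (h ▸ ht)
  have hcont : Continuous (extendFrom Fᶜ w) := by
    refine continuous_extendFrom hdense fun t => ?_
    by_cases ht : t ∈ F
    · by_cases htK : t ∈ K
      · obtain ⟨a, b, ha, hb⟩ := hlim t ⟨ht, hKO htK⟩
        exact ⟨_, ((ha.mono_left (hle t ht)).mul
          ((hφ₁ t).continuousAt.tendsto.mono_left nhdsWithin_le_nhds)).sub
          ((hb.mono_left (hle t ht)).mul
          ((hφ t).continuousAt.tendsto.mono_left nhdsWithin_le_nhds))⟩
      · refine ⟨0, tendsto_const_nhds.congr' ?_⟩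
        filter_upwards [nhdsWithin_le_nhds (hK.isClosed.isOpen_compl.mem_nhds htK)] with s hs
        simp [hw, hv s hs, hv₁ s hs]
    · exact ⟨_, (hd t ht).continuousAt.tendsto.mono_left nhdsWithin_le_nhds⟩
  have heq : ∀ t ∉ F, extendFrom Fᶜ w t = w t := fun t ht =>
    extendFrom_eq (hdense t) ((hd t ht).continuousAt.tendsto.mono_left nhdsWithin_le_nhds)
  obtain ⟨R, hR0, hR⟩ := (hK.union hF.isCompact).isBounded.subset_ball_lt 0 0
  have hout : ∀ t, R ≤ |t| → t ∉ K ∧ t ∉ F := by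
    intro t ht
    have : t ∉ K ∪ F := fun h => by
      have := hR h
      rw [mem_ball_zero_iff, Real.norm_eq_abs] at this
      linarith
    exact ⟨fun h => this (.inl h), fun h => this (.inr h)⟩
  have hzero : ∀ t, R ≤ |t| → extendFrom Fᶜ w t = 0 := fun t ht => by
    rw [heq t (hout t ht).2]
    simp [hw, hv t (hout t ht).1, hv₁ t (hout t ht).1]
  have key := integral_eq_of_hasDerivAt_off_countable (extendFrom Fᶜ w)
    (fun t => g t * φ₂ t - g₂ t * φ t) (a := -R) (b := R) hF.countable hcont.continuousOn
    (fun t ht => (hd t ht.2).congr_of_eventuallyEq (by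
      filter_upwards [hopen.mem_nhds ht.2] with s hs using heq s hs))
    (hi.sub hi₂).intervalIntegrable
  rw [hzero R (le_abs_self R), hzero (-R) (by rw [abs_neg]; exact le_abs_self R), sub_zero,
    intervalIntegral.integral_of_le (by linarith),
    setIntegral_eq_integral_of_forall_compl_eq_zero, integral_sub hi hi₂, sub_eq_zero] at key
  · exact key
  · intro t ht
    have : R ≤ |t| := by
      by_contra! h
      exact ht ⟨(abs_lt.1 h).1, (abs_lt.1 h).2.le⟩
    simp [hv t (hout t this).1, hv₂ t (hout t this).1]

/-! ### Fubini along coordinate lines -/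

variable {n : ℕ}

/-- The measurable equivalence `(t, X) ↦ coordPoint j t X`. -/
noncomputable def coordEquiv (j : Fin n) :
    ℝ × EuclideanSpace ℝ {i : Fin n // i ≠ j} ≃ᵐ EuclideanSpace ℝ (Fin n) :=
  ((MeasurableEquiv.prodCongr (MeasurableEquiv.funUnique {i : Fin n // i = j} ℝ).symm
    (MeasurableEquiv.toLp 2 ({i : Fin n // i ≠ j} → ℝ)).symm).trans
    (MeasurableEquiv.piEquivPiSubtypeProd (fun _ : Fin n => ℝ) (· = j)).symm).trans
    (MeasurableEquiv.toLp 2 (Fin n → ℝ))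

theorem measurePreserving_coordEquiv (j : Fin n) :
    MeasurePreserving (coordEquiv j) (volume.prod volume) volume := by
  have h1 := (volume_preserving_funUnique {i : Fin n // i = j} ℝ).symm
  have h2 := EuclideanSpace.volume_preserving_symm_measurableEquiv_toLp {i : Fin n // i ≠ j}
  have h3 : MeasurePreserving
      (MeasurableEquiv.piEquivPiSubtypeProd (fun _ : Fin n => ℝ) (· = j)).symm
      ((volume : Measure ({i : Fin n // i = j} → ℝ)).prod
        (volume : Measure ({i : Fin n // i ≠ j} → ℝ))) volume := by
    convert (volume_preserving_piEquivPiSubtypeProd (fun _ : Fin n => ℝ) (· = j)).symm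
    · rfl
    · rw [Measure.volume_eq_prod]
      congr!
  have h12 : MeasurePreserving (MeasurableEquiv.prodCongr
      (MeasurableEquiv.funUnique {i : Fin n // i = j} ℝ).symm
      (MeasurableEquiv.toLp 2 ({i : Fin n // i ≠ j} → ℝ)).symm) (volume.prod volume)
      (volume.prod volume) := by
    convert h1.prod h2 <;> rfl
  have h4 := h3.comp h12
  exact ((EuclideanSpace.volume_preserving_symm_measurableEquiv_toLp (Fin n)).symm).comp h4

theorem integral_eq_integral_integral_coordPoint (j : Fin n) {f : EuclideanSpace ℝ (Fin n) → ℝ}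
    (hf : Integrable f) : ∫ x, f x = ∫ X, ∫ t, f (coordPoint j t X) := by
  have hp := measurePreserving_coordEquiv j
  rw [← hp.integral_comp (coordEquiv j).measurableEmbedding]
  exact integral_prod_symm (fun p => f (coordEquiv j p))
    ((hp.integrable_comp_emb (coordEquiv j).measurableEmbedding).2 hf)

theorem ae_integrable_coordPoint (j : Fin n) {f : EuclideanSpace ℝ (Fin n) → ℝ}
    (hf : Integrable f) : ∀ᵐ X, Integrable fun t => f (coordPoint j t X) :=
  Integrable.prod_left_ae (((measurePreserving_coordEquiv j).integrable_comp_emb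
    (coordEquiv j).measurableEmbedding).2 hf)

/-- The projection forgetting the `j`-th coordinate. -/
noncomputable def forget (j : Fin n) (x : EuclideanSpace ℝ (Fin n)) :
    EuclideanSpace ℝ {i : Fin n // i ≠ j} := WithLp.toLp 2 fun i => x i

theorem forget_coordPoint (j : Fin n) (t : ℝ) (X : EuclideanSpace ℝ {i : Fin n // i ≠ j}) :
    forget j (coordPoint j t X) = X := by
  ext i
  simp [forget, coordPoint, i.2]

theorem coordPoint_self (j : Fin n) (t : ℝ) (X : EuclideanSpace ℝ {i : Fin n // i ≠ j}) :
    coordPoint j t X j = t := by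
  simp [coordPoint]

theorem lipschitzWith_forget (j : Fin n) : LipschitzWith 1 (forget j) := by
  refine LipschitzWith.of_dist_le_mul fun x y => ?_
  rw [NNReal.coe_one, one_mul, EuclideanSpace.dist_eq, EuclideanSpace.dist_eq]
  refine Real.sqrt_le_sqrt ?_
  calc ∑ i : {i // i ≠ j}, dist (forget j x i) (forget j y i) ^ 2
      = ∑ i ∈ Finset.univ.filter (· ≠ j), dist (x i) (y i) ^ 2 :=
        (Finset.sum_subtype (Finset.univ.filter (· ≠ j)) (by simp)
          fun i => dist (x i) (y i) ^ 2).symm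
    _ ≤ _ := Finset.sum_le_sum_of_subset_of_nonneg (Finset.filter_subset _ _)
        fun _ _ _ => by positivity

/-! ### Hausdorff measure and finite sections -/

/-- Almost every line parallel to a coordinate axis meets a set of finite Hausdorff measure of
codimension one in finitely many points. -/
theorem ae_finite_lineSection {d : ℝ} (hd : 0 ≤ d) {E : Set (EuclideanSpace ℝ (Fin n))}
    (hE : Measure.hausdorffMeasure d E < ⊤) (j : Fin n) :
    ∀ᵐ X : EuclideanSpace ℝ {i : Fin n // i ≠ j} ∂(Measure.hausdorffMeasure d),
      (lineSection E j X).Finite := by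
  set μ : Measure (EuclideanSpace ℝ {i : Fin n // i ≠ j}) := Measure.hausdorffMeasure d with hμ
  -- For `m > 0` these are slabs of width `1 / m` orthogonal to the `j`-th axis. `N m X` below
  -- bounds from above the number of slabs in which the line over `X` meets `E`; measurable hulls
  -- are used since the projections need not be measurable.
  let S : ℕ → ℤ → Set (EuclideanSpace ℝ (Fin n)) := fun m i => {x | ⌊(m : ℝ) * x j⌋ = i}
  have hS : ∀ m i, MeasurableSet (S m i) := fun m i =>
    (Int.measurable_floor.comp (measurable_const.mul
      (by fun_prop : Measurable fun x : EuclideanSpace ℝ (Fin n) => x j)))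
      (measurableSet_singleton i)
  let T : ℕ → ℤ → Set (EuclideanSpace ℝ {i : Fin n // i ≠ j}) := fun m i =>
    toMeasurable μ (forget j '' (E ∩ S m i))
  have hT : ∀ m i, MeasurableSet (T m i) := fun m i => measurableSet_toMeasurable _ _
  let N : ℕ → EuclideanSpace ℝ {i : Fin n // i ≠ j} → ENNReal := fun m X =>
    ∑' i, (T m i).indicator 1 X
  have hNm : ∀ m, Measurable (N m) := fun m =>
    Measurable.tsum fun i => measurable_one.indicator (hT m i)
  have hNint : ∀ m, ∫⁻ X, N m X ∂μ ≤ Measure.hausdorffMeasure d E := by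
    intro m
    rw [lintegral_tsum fun i => (measurable_one.indicator (hT m i)).aemeasurable]
    calc ∑' i, ∫⁻ X, (T m i).indicator 1 X ∂μ
        = ∑' i, μ (forget j '' (E ∩ S m i)) := by
          congr 1; ext i
          rw [lintegral_indicator_one (hT m i), measure_toMeasurable]
      _ ≤ ∑' i, (Measure.hausdorffMeasure d).restrict E (S m i) := by
          refine ENNReal.tsum_le_tsum fun i => ?_
          rw [Measure.restrict_apply (hS m i), inter_comm]
          simpa using (lipschitzWith_forget j).hausdorffMeasure_image_le hd (S m i ∩ E)
      _ = (Measure.hausdorffMeasure d).restrict E (⋃ i, S m i) := by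
          refine (measure_iUnion (fun i k hik => ?_) (hS m)).symm
          exact disjoint_left.2 fun x hx hx' => hik (hx.symm.trans hx')
      _ ≤ (Measure.hausdorffMeasure d).restrict E univ := measure_mono (subset_univ _)
      _ = _ := Measure.restrict_apply_univ E
  -- Fatou rather than monotone convergence: the slab partitions for successive `m` are not nested.
  have hlim : ∫⁻ X, liminf (fun m => N m X) atTop ∂μ ≠ ⊤ := by
    refine ((lintegral_liminf_le hNm).trans ?_).trans_lt hE |>.ne
    exact liminf_le_of_le (by isBoundedDefault) fun b hb =>
      let ⟨m, hm⟩ := hb.exists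
      hm.trans (hNint m)
  filter_upwards [ae_lt_top (Measurable.liminf hNm) hlim] with X hX
  by_contra hinf
  refine hX.ne (ENNReal.eq_top_of_forall_nnreal_le fun r => ?_)
  obtain ⟨k, hk⟩ := exists_nat_ge r
  obtain ⟨A, hA, hAk⟩ := Set.Infinite.exists_subset_card_eq hinf k
  -- Any `k` points of the section lie in distinct slabs once `m` is large, so an infinite section
  -- would force the lower limit of `N m X` to be infinite.
  have hinj : ∀ᶠ m : ℕ in atTop, ∀ s ∈ A, ∀ t ∈ A, s ≠ t → ⌊(m : ℝ) * s⌋ ≠ ⌊(m : ℝ) * t⌋ := by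
    refine (Filter.eventually_all_finset A).2 fun s _ =>
      (Filter.eventually_all_finset A).2 fun t _ => ?_
    by_cases hst : s = t
    · exact Eventually.of_forall fun _ h => absurd hst h
    · have hpos : 0 < |s - t| := abs_pos.2 (sub_ne_zero.2 hst)
      filter_upwards [(tendsto_natCast_atTop_atTop.atTop_mul_const hpos).eventually_ge_atTop 1]
        with m hm _ hfl
      have := Int.abs_sub_lt_one_of_floor_eq_floor hfl
      rw [← mul_sub, abs_mul, abs_of_nonneg (Nat.cast_nonneg m)] at this
      linarith
  refine le_liminf_of_le (by isBoundedDefault) ?_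
  filter_upwards [hinj] with m hm
  have hinjOn : Set.InjOn (fun t : ℝ => ⌊(m : ℝ) * t⌋) A := fun s hs t ht h => by
    by_contra hne
    exact hm s hs t ht hne h
  calc (r : ENNReal) ≤ k := by exact_mod_cast hk
    _ = ∑ i ∈ A.image fun t : ℝ => ⌊(m : ℝ) * t⌋, (1 : ENNReal) := by
        simp [Finset.card_image_of_injOn hinjOn, hAk]
    _ = ∑ i ∈ A.image fun t : ℝ => ⌊(m : ℝ) * t⌋, (T m i).indicator 1 X := by
        refine Finset.sum_congr rfl fun i hi => ?_
        obtain ⟨t, ht, rfl⟩ := Finset.mem_image.1 hi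
        rw [indicator_of_mem, Pi.one_apply]
        refine subset_toMeasurable _ _ ⟨coordPoint j t X, ⟨hA ht, ?_⟩, forget_coordPoint j t X⟩
        change ⌊(m : ℝ) * coordPoint j t X j⌋ = _
        rw [coordPoint_self]
    _ ≤ N m X := ENNReal.sum_le_tsum _

/-- In the full dimension Hausdorff measure is a Haar measure, so it has the same null sets as
Lebesgue measure. -/
theorem ae_volume_of_ae_hausdorffMeasure {ι : Type*} [Fintype ι] {d : ℝ}
    (hd : d = Fintype.card ι) {p : EuclideanSpace ℝ ι → Prop}
    (h : ∀ᵐ X ∂(Measure.hausdorffMeasure d), p X) : ∀ᵐ X, p X := by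
  have : (Measure.hausdorffMeasure d : Measure (EuclideanSpace ℝ ι)).IsAddHaarMeasure := by
    rw [hd, ← finrank_euclideanSpace (𝕜 := ℝ) (ι := ι)]
    exact isAddHaarMeasure_hausdorffMeasure
  exact (Measure.absolutelyContinuous_isAddHaarMeasure volume
    (Measure.hausdorffMeasure d)).ae_le h

theorem volume_eq_zero_of_hausdorffMeasure_lt_top {E : Set (EuclideanSpace ℝ (Fin n))} {d : ℝ}
    (hd : d < n) (hE : Measure.hausdorffMeasure d E < ⊤) : volume E = 0 := by
  have h0 : Measure.hausdorffMeasure (n : ℝ) E = 0 :=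
    (Measure.hausdorffMeasure_zero_or_top hd E).resolve_right hE.ne
  have := ae_volume_of_ae_hausdorffMeasure (ι := Fin n) (d := n) (by simp)
    (p := (· ∉ E)) (by rwa [← compl_compl E] at h0)
  simpa [ae_iff] using this

/-! ### Partial derivatives and the Laplacian -/

theorem coordPoint_eq_add (j : Fin n) (t : ℝ) (X : EuclideanSpace ℝ {i : Fin n // i ≠ j}) :
    coordPoint j t X = coordPoint j 0 X + t • EuclideanSpace.single j (1 : ℝ) := by
  ext i
  by_cases h : i = j
  · subst h; simp [coordPoint]
  · simp [coordPoint, h]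

theorem hasDerivAt_coordPoint (j : Fin n) (t : ℝ) (X : EuclideanSpace ℝ {i : Fin n // i ≠ j}) :
    HasDerivAt (fun s => coordPoint j s X) (EuclideanSpace.single j (1 : ℝ)) t := by
  rw [funext fun s => coordPoint_eq_add j s X]
  simpa using ((hasDerivAt_id t).smul_const (EuclideanSpace.single j (1 : ℝ))).const_add
    (coordPoint j 0 X)

theorem continuous_coordPoint (j : Fin n) (X : EuclideanSpace ℝ {i : Fin n // i ≠ j}) :
    Continuous fun s => coordPoint j s X :=
  continuous_iff_continuousAt.2 fun t => (hasDerivAt_coordPoint j t X).continuousAt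

theorem hasDerivAt_comp_coordPoint {j : Fin n} {t : ℝ} {X : EuclideanSpace ℝ {i : Fin n // i ≠ j}}
    {f : EuclideanSpace ℝ (Fin n) → ℝ} (hf : DifferentiableAt ℝ f (coordPoint j t X)) :
    HasDerivAt (fun s => f (coordPoint j s X)) (partialDeriv j f (coordPoint j t X)) t := by
  rw [partialDeriv, hf.lineDeriv_eq_fderiv]
  exact hf.hasFDerivAt.comp_hasDerivAt t (hasDerivAt_coordPoint j t X)

theorem partialDeriv_eventuallyEq (j : Fin n) {f : EuclideanSpace ℝ (Fin n) → ℝ}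
    {x : EuclideanSpace ℝ (Fin n)} (hf : ContDiffAt ℝ 2 f x) :
    partialDeriv j f =ᶠ[𝓝 x] fun y => fderiv ℝ f y (EuclideanSpace.single j 1) := by
  filter_upwards [hf.eventually (by simp)] with y hy
  exact (hy.differentiableAt (by simp)).lineDeriv_eq_fderiv

theorem hasFDerivAt_partialDeriv (j : Fin n) {f : EuclideanSpace ℝ (Fin n) → ℝ}
    {x : EuclideanSpace ℝ (Fin n)} (hf : ContDiffAt ℝ 2 f x) :
    HasFDerivAt (partialDeriv j f)
      ((fderiv ℝ (fderiv ℝ f) x).flip (EuclideanSpace.single j 1)) x := by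
  have h : DifferentiableAt ℝ (fderiv ℝ f) x :=
    (hf.fderiv_right (m := 1) (by norm_num)).differentiableAt (by simp)
  have := h.hasFDerivAt.clm_apply (hasFDerivAt_const (EuclideanSpace.single j (1 : ℝ)) x)
  rw [ContinuousLinearMap.comp_zero, zero_add] at this
  exact this.congr_of_eventuallyEq (partialDeriv_eventuallyEq j hf)

theorem sum_partialDeriv_partialDeriv {f : EuclideanSpace ℝ (Fin n) → ℝ}
    {x : EuclideanSpace ℝ (Fin n)} (hf : ContDiffAt ℝ 2 f x) :
    ∑ j, partialDeriv j (partialDeriv j f) x = Laplacian.laplacian f x := by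
  rw [InnerProductSpace.laplacian_eq_iteratedFDeriv_orthonormalBasis f
    (EuclideanSpace.basisFun (Fin n) ℝ)]
  refine Finset.sum_congr rfl fun j _ => ?_
  have h := hasFDerivAt_partialDeriv j hf
  rw [partialDeriv, h.differentiableAt.lineDeriv_eq_fderiv, h.fderiv, iteratedFDeriv_two_apply]
  simp

/-! ### Weak harmonicity across the exceptional set -/

theorem integrable_mul_of_locallyIntegrableOn {Ω K : Set (EuclideanSpace ℝ (Fin n))}
    {f φ : EuclideanSpace ℝ (Fin n) → ℝ} (hf : LocallyIntegrableOn f Ω volume)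
    (hK : IsCompact K) (hKΩ : K ⊆ Ω) (hφ : Continuous φ) (hv : ∀ x ∉ K, φ x = 0) :
    Integrable fun x => f x * φ x := by
  have h := (hf.integrableOn_compact_subset hKΩ hK).mul_continuousOn hφ.continuousOn hK
  refine (integrableOn_iff_integrable_of_support_subset fun x hx => ?_).1 h
  by_contra hxK
  exact hx (by simp [hv x hxK])

theorem integral_mul_second_partialDeriv_eq {Ω E : Set (EuclideanSpace ℝ (Fin n))}
    (hΩ : IsOpen Ω) {u : EuclideanSpace ℝ (Fin n) → ℝ}
    (hu : ∀ x ∈ Ω \ E, ContDiffAt ℝ 2 u x) (hu_int : LocallyIntegrableOn u Ω volume) (j : Fin n)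
    (hu_int₂ : LocallyIntegrableOn (partialDeriv j (partialDeriv j u)) Ω volume)
    (hfin : ∀ᵐ X, (lineSection E j X).Finite)
    (hmatch : ∀ᵐ X : EuclideanSpace ℝ {i : Fin n // i ≠ j},
      ∀ t ∈ lineSection E j X, MatchesAt Ω E u j X t)
    {K : Set (EuclideanSpace ℝ (Fin n))} (hK : IsCompact K) (hKΩ : K ⊆ Ω)
    {φ φ₁ φ₂ : EuclideanSpace ℝ (Fin n) → ℝ} (hφc : Continuous φ) (hφ₂c : Continuous φ₂)
    (hφ : ∀ t X, HasDerivAt (fun s => φ (coordPoint j s X)) (φ₁ (coordPoint j t X)) t)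
    (hφ₁ : ∀ t X, HasDerivAt (fun s => φ₁ (coordPoint j s X)) (φ₂ (coordPoint j t X)) t)
    (hv : ∀ x ∉ K, φ x = 0) (hv₁ : ∀ x ∉ K, φ₁ x = 0) (hv₂ : ∀ x ∉ K, φ₂ x = 0) :
    ∫ x, u x * φ₂ x = ∫ x, partialDeriv j (partialDeriv j u) x * φ x := by
  have hi := integrable_mul_of_locallyIntegrableOn hu_int hK hKΩ hφ₂c hv₂
  have hi₂ := integrable_mul_of_locallyIntegrableOn hu_int₂ hK hKΩ hφc hv
  rw [integral_eq_integral_integral_coordPoint j hi, integral_eq_integral_integral_coordPoint j hi₂]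
  -- The one-sided limits need the second derivative itself, not its product with `φ`, to be
  -- integrable near the exceptional points in `K`; hence a larger compact set.
  obtain ⟨K', hK', hKK', hK'Ω⟩ := exists_compact_between hK hΩ hKΩ
  have hi' := (integrable_indicator_iff hK'.measurableSet).2
    (hu_int₂.integrableOn_compact_subset hK'Ω hK')
  refine integral_congr_ae ?_
  filter_upwards [hfin, hmatch, ae_integrable_coordPoint j hi, ae_integrable_coordPoint j hi₂,
    ae_integrable_coordPoint j hi'] with X hF hm h1 h2 h3
  have hc := continuous_coordPoint j X
  have hKc : IsCompact (lineSection K j X) := by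
    refine (hK.image (f := fun x => x j) (by fun_prop)).of_isClosed_subset
      (hK.isClosed.preimage hc) fun t ht => ⟨_, ht, coordPoint_self j t X⟩
  have hO : IsOpen (lineSection (interior K') j X) := isOpen_interior.preimage hc
  have hOi : IntegrableOn (fun t => partialDeriv j (partialDeriv j u) (coordPoint j t X))
      (lineSection (interior K') j X) := by
    rw [← integrable_indicator_iff hO.measurableSet]
    refine (h3.indicator hO.measurableSet).congr (Eventually.of_forall fun t => ?_)
    by_cases ht : t ∈ lineSection (interior K') j X
    · simp only [indicator_of_mem ht]
      exact indicator_of_mem (interior_subset ht) _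
    · simp only [indicator_of_notMem ht]
  have hd : ∀ t ∈ lineSection (interior K') j X \ lineSection E j X,
      ContDiffAt ℝ 2 u (coordPoint j t X) := fun t ht =>
    hu _ ⟨hK'Ω (interior_subset ht.1), ht.2⟩
  have hd₁ : ∀ t ∈ lineSection (interior K') j X \ lineSection E j X,
      HasDerivAt (fun s => u (coordPoint j s X)) (partialDeriv j u (coordPoint j t X)) t :=
    fun t ht => hasDerivAt_comp_coordPoint ((hd t ht).differentiableAt (by simp))
  have hd₂ : ∀ t ∈ lineSection (interior K') j X \ lineSection E j X,
      HasDerivAt (fun s => partialDeriv j u (coordPoint j s X))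
        (partialDeriv j (partialDeriv j u) (coordPoint j t X)) t := fun t ht =>
    hasDerivAt_comp_coordPoint (hasFDerivAt_partialDeriv j (hd t ht)).differentiableAt
  refine integral_mul_second_deriv_eq hF hKc (O := lineSection (interior K') j X)
    (fun t ht => hKK' ht) (hφ · X) (hφ₁ · X) (fun t ht => hv _ ht) (fun t ht => hv₁ _ ht)
    (fun t ht => hv₂ _ ht) hd₁ hd₂ (fun t ht => ?_) h1 h2
  obtain ⟨s₁, s₂, hs₁, hs₂, hs₁m, hs₁t, hs₂m, hs₂t, ⟨a, ha₁, ha₂⟩, b, hb₁, hb₂⟩ := hm t ht.1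
  have hnhds : lineSection (interior K') j X \ (lineSection E j X \ {t}) ∈ 𝓝 t :=
    (hO.sdiff (hF.subset sdiff_subset).isClosed).mem_nhds ⟨ht.2, fun h => h.2 rfl⟩
  obtain ⟨δ, hδ, hsub⟩ := Metric.mem_nhds_iff.1 hnhds
  rw [Real.ball_eq_Ioo] at hsub
  have hmem : ∀ s ∈ Ioo (t - δ) (t + δ), s ≠ t →
      s ∈ lineSection (interior K') j X \ lineSection E j X := fun s hs hst =>
    ⟨(hsub hs).1, fun h => (hsub hs).2 ⟨h, hst⟩⟩
  -- Monotonicity gives only `≤`; equality is excluded because `t` lies in the section of `E` and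
  -- the sequence avoids it.
  have hlt : ∀ l, s₁ l < t := fun l => (hs₁m.ge_of_tendsto hs₁t l).lt_of_ne fun h =>
    (hs₁ l).2 (by rw [h]; exact ht.1)
  have hgt : ∀ l, t < s₂ l := fun l => (hs₂m.le_of_tendsto hs₂t l).lt_of_ne fun h =>
    (hs₂ l).2 (by rw [← h]; exact ht.1)
  exact ⟨a, b, exists_tendsto_punctured hδ (fun s hs hst => hd₁ s (hmem s hs hst))
    (fun s hs hst => hd₂ s (hmem s hs hst)) (hOi.mono_set fun s hs => (hsub hs).1)
    (tendsto_nhdsWithin_iff.2 ⟨hs₁t, Eventually.of_forall hlt⟩)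
    (tendsto_nhdsWithin_iff.2 ⟨hs₂t, Eventually.of_forall hgt⟩) ha₁ ha₂ hb₁ hb₂⟩

/-! ### Radial test functions -/

/-- A smooth nonnegative profile on the real line vanishing on `[1, ∞)`. -/
noncomputable def profile (t : ℝ) : ℝ := expNegInvGlue (1 - t)

/-- The primitive of `profile` vanishing on `[1, ∞)`. -/
noncomputable def profilePrimitive (t : ℝ) : ℝ := ∫ s in (1 : ℝ)..t, profile s

theorem contDiff_profile {m : ℕ∞} : ContDiff ℝ m profile :=
  expNegInvGlue.contDiff.comp (contDiff_const.sub contDiff_id)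

theorem profile_nonneg (t : ℝ) : 0 ≤ profile t := expNegInvGlue.nonneg _

theorem profile_eq_zero {t : ℝ} (ht : 1 ≤ t) : profile t = 0 :=
  expNegInvGlue.zero_of_nonpos (by linarith)

theorem continuous_profile : Continuous profile := (contDiff_profile (m := 0)).continuous

theorem hasDerivAt_profile (t : ℝ) : HasDerivAt profile (deriv profile t) t :=
  ((contDiff_profile (m := 1)).differentiable (by simp) t).hasDerivAt

theorem continuous_deriv_profile : Continuous (deriv profile) :=
  (contDiff_profile (m := 1)).continuous_deriv (by simp)

/-- Zeros of a nonnegative function are minima, which also covers the endpoint `t = 1`. -/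
theorem deriv_profile_eq_zero {t : ℝ} (ht : 1 ≤ t) : deriv profile t = 0 :=
  IsLocalMin.deriv_eq_zero (Eventually.of_forall fun s => by
    rw [profile_eq_zero ht]; exact profile_nonneg s)

theorem hasDerivAt_profilePrimitive (t : ℝ) :
    HasDerivAt profilePrimitive (profile t) t :=
  intervalIntegral.integral_hasDerivAt_right (continuous_profile.intervalIntegrable _ _)
    (continuous_profile.stronglyMeasurableAtFilter _ _) continuous_profile.continuousAt

theorem profilePrimitive_eq_zero {t : ℝ} (ht : 1 ≤ t) : profilePrimitive t = 0 := by
  refine intervalIntegral.integral_zero_ae (Eventually.of_forall fun s hs => ?_)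
  rw [uIoc_of_le ht] at hs
  exact profile_eq_zero hs.1.le

theorem one_le_sq_mul_of_notMem_closedBall {V : Type*} [SeminormedAddCommGroup V] {c : ℝ}
    (hc : 0 < c) {x y : V} (hy : y ∉ Metric.closedBall x (1 / c)) : 1 ≤ c ^ 2 * ‖y - x‖ ^ 2 := by
  rw [mem_closedBall_iff_norm, not_le, div_lt_iff₀ hc] at hy
  rw [← mul_pow]
  nlinarith

theorem hasDerivAt_norm_sq_coordPoint (j : Fin n) (x : EuclideanSpace ℝ (Fin n)) (t : ℝ)
    (X : EuclideanSpace ℝ {i : Fin n // i ≠ j}) :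
    HasDerivAt (fun s => ‖coordPoint j s X - x‖ ^ 2) (2 * (coordPoint j t X j - x j)) t := by
  have := ((hasDerivAt_coordPoint j t X).sub_const x).norm_sq
  simpa [EuclideanSpace.inner_single_right] using this

/-- Weak harmonicity tested against the Laplacian of a radial bump, written in terms of its
profile. -/
theorem integral_mul_laplacian_radial_eq_zero {Ω E : Set (EuclideanSpace ℝ (Fin n))}
    (hΩ : IsOpen Ω) {u : EuclideanSpace ℝ (Fin n) → ℝ}
    (hu : InnerProductSpace.HarmonicOnNhd u (Ω \ E)) (hE : volume E = 0)
    (hu_int : LocallyIntegrableOn u Ω volume)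
    (hu_int₂ : ∀ j, LocallyIntegrableOn (partialDeriv j (partialDeriv j u)) Ω volume)
    (hfin : ∀ j, ∀ᵐ X, (lineSection E j X).Finite)
    (hmatch : ∀ j, ∀ᵐ X : EuclideanSpace ℝ {i : Fin n // i ≠ j},
      ∀ t ∈ lineSection E j X, MatchesAt Ω E u j X t)
    {x : EuclideanSpace ℝ (Fin n)} {c : ℝ} (hc : 0 < c)
    (hx : Metric.closedBall x (1 / c) ⊆ Ω) :
    ∫ y, u y * (n * profile (c ^ 2 * ‖y - x‖ ^ 2) +
      2 * (c ^ 2 * ‖y - x‖ ^ 2) * deriv profile (c ^ 2 * ‖y - x‖ ^ 2)) = 0 := by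
  have hK : IsCompact (Metric.closedBall x (1 / c)) := isCompact_closedBall _ _
  have cp := continuous_profile
  have cd := continuous_deriv_profile
  let q : EuclideanSpace ℝ (Fin n) → ℝ := fun y => c ^ 2 * ‖y - x‖ ^ 2
  have hq : Continuous q := by fun_prop
  have hq1 : ∀ y ∉ Metric.closedBall x (1 / c), 1 ≤ q y := fun y hy =>
    one_le_sq_mul_of_notMem_closedBall hc hy
  let φ : EuclideanSpace ℝ (Fin n) → ℝ := fun y => profilePrimitive (q y)
  let φ₁ : Fin n → EuclideanSpace ℝ (Fin n) → ℝ := fun j y =>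
    profile (q y) * (c ^ 2 * (2 * (y j - x j)))
  let φ₂ : Fin n → EuclideanSpace ℝ (Fin n) → ℝ := fun j y =>
    deriv profile (q y) * (c ^ 2 * (2 * (y j - x j))) * (c ^ 2 * (2 * (y j - x j))) +
      profile (q y) * (c ^ 2 * 2)
  have hφc : Continuous φ :=
    (continuous_iff_continuousAt.2 fun t => (hasDerivAt_profilePrimitive t).continuousAt).comp hq
  have hφ₂c : ∀ j, Continuous (φ₂ j) := fun j => by fun_prop
  have hv : ∀ y ∉ Metric.closedBall x (1 / c), φ y = 0 := fun y hy =>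
    profilePrimitive_eq_zero (hq1 y hy)
  have hv₂ : ∀ j, ∀ y ∉ Metric.closedBall x (1 / c), φ₂ j y = 0 := fun j y hy => by
    simp [φ₂, profile_eq_zero (hq1 y hy), deriv_profile_eq_zero (hq1 y hy)]
  have key : ∀ j, ∫ y, u y * φ₂ j y = ∫ y, partialDeriv j (partialDeriv j u) y * φ y := by
    intro j
    refine integral_mul_second_partialDeriv_eq hΩ (fun y hy => (hu y hy).1) hu_int j (hu_int₂ j)
      (hfin j) (hmatch j) hK hx hφc (hφ₂c j) (φ₁ := φ₁ j) (fun t X => ?_) (fun t X => ?_) hv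
      (fun y hy => by simp [φ₁, profile_eq_zero (hq1 y hy)]) (hv₂ j)
    · exact (hasDerivAt_profilePrimitive _).comp t
        ((hasDerivAt_norm_sq_coordPoint j x t X).const_mul (c ^ 2))
    · have h1 := (hasDerivAt_profile _).comp t
        ((hasDerivAt_norm_sq_coordPoint j x t X).const_mul (c ^ 2))
      have h2 : HasDerivAt (fun s => c ^ 2 * (2 * (coordPoint j s X j - x j))) (c ^ 2 * 2) t := by
        simp only [coordPoint_self]
        simpa using (((hasDerivAt_id t).sub_const (x j)).const_mul 2).const_mul (c ^ 2)
      exact h1.mul h2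
  have hlap : ∑ j, ∫ y, u y * φ₂ j y = 0 := by
    rw [Finset.sum_congr rfl fun j _ => key j, ← integral_finsetSum]
    · refine integral_eq_zero_of_ae ?_
      filter_upwards [compl_mem_ae_iff.2 hE] with y hyE
      rw [← Finset.sum_mul]
      by_cases hy : y ∈ Metric.closedBall x (1 / c)
      · have := hu y ⟨hx hy, hyE⟩
        rw [sum_partialDeriv_partialDeriv this.1, this.2.self_of_nhds]
        simp
      · simp [hv y hy]
    · exact fun j _ => integrable_mul_of_locallyIntegrableOn (hu_int₂ j) hK hx hφc hv
  rw [← integral_finsetSum _ fun j _ =>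
    integrable_mul_of_locallyIntegrableOn hu_int hK hx (hφ₂c j) (hv₂ j)] at hlap
  -- `∑ j, φ₂ j` is the Laplacian of `φ`; the sum of squared coordinates turns it into a function of
  -- `‖y - x‖²`.
  have hpt : ∀ y, ∑ j, u y * φ₂ j y = (2 * c ^ 2) * (u y * (n * profile (c ^ 2 * ‖y - x‖ ^ 2) +
      2 * (c ^ 2 * ‖y - x‖ ^ 2) * deriv profile (c ^ 2 * ‖y - x‖ ^ 2))) := by
    intro y
    have hn : ‖y - x‖ ^ 2 = ∑ j, (y j - x j) ^ 2 := by
      simp [EuclideanSpace.norm_sq_eq]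
    have : ∑ j, φ₂ j y = deriv profile (q y) * (4 * c ^ 4) * ∑ j, (y j - x j) ^ 2 +
        n * (profile (q y) * (c ^ 2 * 2)) := by
      rw [Finset.sum_add_distrib, Finset.mul_sum]
      congr 1
      · exact Finset.sum_congr rfl fun j _ => by ring
      · simp
    rw [← Finset.mul_sum, this, ← hn]
    simp only [q]; ring
  rw [integral_congr_ae (Eventually.of_forall hpt), integral_const_mul] at hlap
  exact (mul_eq_zero.1 hlap).resolve_left (by positivity)

/-! ### Radial averages: independence of scale, limit, smoothness -/

/-- The unnormalised radial average of `u` around `x` at scale `1 / c`. -/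
noncomputable def radialAverage (u : EuclideanSpace ℝ (Fin n) → ℝ) (x : EuclideanSpace ℝ (Fin n))
    (c : ℝ) : ℝ := ∫ y, u y * (c ^ n * profile (c ^ 2 * ‖y - x‖ ^ 2))

/-- The power `c ^ n` is chosen so that this derivative is a multiple of the Laplacian of the radial
test function. -/
theorem hasDerivAt_radialKernel (hn : n ≠ 0) (r c : ℝ) :
    HasDerivAt (fun c : ℝ => c ^ n * profile (c ^ 2 * r))
      (c ^ (n - 1) * (n * profile (c ^ 2 * r) + 2 * (c ^ 2 * r) * deriv profile (c ^ 2 * r)))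
      c := by
  have h1 : HasDerivAt (fun c : ℝ => profile (c ^ 2 * r))
      (deriv profile (c ^ 2 * r) * (2 * c * r)) c := by
    have h2 : HasDerivAt (fun c : ℝ => c ^ 2 * r) (2 * c * r) c := by
      simpa using (hasDerivAt_pow 2 c).mul_const r
    exact HasDerivAt.comp c (h := fun c : ℝ => c ^ 2 * r) (hasDerivAt_profile _) h2
  refine ((hasDerivAt_pow n c).mul h1).congr_deriv ?_
  obtain ⟨m, rfl⟩ := Nat.exists_eq_succ_of_ne_zero hn
  simp only [Nat.succ_eq_add_one, Nat.add_sub_cancel]; ring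

theorem exists_bound_radialKernel_deriv (n : ℕ) :
    ∃ M, ∀ s : ℝ, 0 ≤ s → |n * profile s + 2 * s * deriv profile s| ≤ M := by
  have cp := continuous_profile
  have cd := continuous_deriv_profile
  obtain ⟨M, hM⟩ := (isCompact_Icc (a := (0 : ℝ)) (b := 1)).exists_bound_of_continuousOn
    (f := fun s : ℝ => n * profile s + 2 * s * deriv profile s) (by fun_prop)
  refine ⟨M, fun s hs => ?_⟩
  rcases le_total s 1 with h | h
  · exact hM s ⟨hs, h⟩
  · rw [profile_eq_zero h, deriv_profile_eq_zero h]
    simpa using (norm_nonneg _).trans (hM 0 ⟨le_rfl, zero_le_one⟩)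

/-- For scales above `c₁` all kernels are supported in one closed ball inside `Ω`, where `|u|` times
a constant dominates the differentiated integrand. -/
theorem hasDerivAt_radialAverage (hn : n ≠ 0) {Ω : Set (EuclideanSpace ℝ (Fin n))}
    {u : EuclideanSpace ℝ (Fin n) → ℝ} (hu_int : LocallyIntegrableOn u Ω volume)
    {x : EuclideanSpace ℝ (Fin n)} {c₁ c : ℝ} (hc₁ : 0 < c₁) (hc : c₁ < c)
    (hx : Metric.closedBall x (1 / c₁) ⊆ Ω) :
    HasDerivAt (radialAverage u x) (c ^ (n - 1) * ∫ y, u y *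
      (n * profile (c ^ 2 * ‖y - x‖ ^ 2) +
      2 * (c ^ 2 * ‖y - x‖ ^ 2) * deriv profile (c ^ 2 * ‖y - x‖ ^ 2))) c := by
  have cp := continuous_profile
  have cd := continuous_deriv_profile
  have hK : IsCompact (Metric.closedBall x (1 / c₁)) := isCompact_closedBall _ _
  have hq1 : ∀ b, c₁ < b → ∀ y ∉ Metric.closedBall x (1 / c₁), 1 ≤ b ^ 2 * ‖y - x‖ ^ 2 :=
    fun b hb y hy => (one_le_sq_mul_of_notMem_closedBall hc₁ hy).trans (by gcongr)
  have hint : ∀ b, c₁ < b →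
      Integrable fun y => u y * (b ^ n * profile (b ^ 2 * ‖y - x‖ ^ 2)) := fun b hb =>
    integrable_mul_of_locallyIntegrableOn hu_int hK hx (by fun_prop)
      fun y hy => by rw [profile_eq_zero (hq1 b hb y hy), mul_zero]
  obtain ⟨M, hM⟩ := exists_bound_radialKernel_deriv n
  have hint' : Integrable fun y => u y * (c ^ (n - 1) * (n * profile (c ^ 2 * ‖y - x‖ ^ 2) +
      2 * (c ^ 2 * ‖y - x‖ ^ 2) * deriv profile (c ^ 2 * ‖y - x‖ ^ 2))) :=
    integrable_mul_of_locallyIntegrableOn hu_int hK hx (by fun_prop) fun y hy => by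
      rw [profile_eq_zero (hq1 c hc y hy), deriv_profile_eq_zero (hq1 c hc y hy)]; simp
  have hbound : Integrable ((Metric.closedBall x (1 / c₁)).indicator
      fun y => ‖u y‖ * ((c + 1) ^ (n - 1) * M)) :=
    (integrable_indicator_iff hK.measurableSet).2
      ((hu_int.integrableOn_compact_subset hx hK).norm.mul_const _)
  have hmain := (hasDerivAt_integral_of_dominated_loc_of_deriv_le (μ := volume)
    (F := fun b y => u y * (b ^ n * profile (b ^ 2 * ‖y - x‖ ^ 2)))
    (F' := fun b y => u y * (b ^ (n - 1) * (n * profile (b ^ 2 * ‖y - x‖ ^ 2) +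
      2 * (b ^ 2 * ‖y - x‖ ^ 2) * deriv profile (b ^ 2 * ‖y - x‖ ^ 2))))
    (x₀ := c) (s := Ioo c₁ (c + 1)) (Ioo_mem_nhds hc (by linarith))
    (by filter_upwards [lt_mem_nhds hc] with b hb using (hint b hb).aestronglyMeasurable)
    (hint c hc) hint'.aestronglyMeasurable (Eventually.of_forall fun y b hb => ?_) hbound
    (Eventually.of_forall fun y b _ => (hasDerivAt_radialKernel hn _ b).const_mul (u y))).2
  · refine hmain.congr_deriv ?_
    rw [← integral_const_mul]
    exact integral_congr_ae (Eventually.of_forall fun y => by ring)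
  · by_cases hy : y ∈ Metric.closedBall x (1 / c₁)
    · rw [indicator_of_mem hy, norm_mul, norm_mul, norm_pow, Real.norm_of_nonneg
        (hc₁.trans hb.1).le]
      have h1 := hM (b ^ 2 * ‖y - x‖ ^ 2) (by positivity)
      have h2 : b ^ (n - 1) ≤ (c + 1) ^ (n - 1) :=
        pow_le_pow_left₀ (hc₁.trans hb.1).le hb.2.le _
      have h3 : (0 : ℝ) ≤ (c + 1) ^ (n - 1) := pow_nonneg (by linarith) _
      exact mul_le_mul_of_nonneg_left (mul_le_mul h2 h1 (abs_nonneg _) h3) (norm_nonneg _)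
    · rw [indicator_of_notMem hy, profile_eq_zero (hq1 b hb.1 y hy),
        deriv_profile_eq_zero (hq1 b hb.1 y hy)]
      simp

theorem radialAverage_eq (hn : n ≠ 0) {Ω : Set (EuclideanSpace ℝ (Fin n))}
    {u : EuclideanSpace ℝ (Fin n) → ℝ} (hu_int : LocallyIntegrableOn u Ω volume)
    (hw : ∀ x c, 0 < c → Metric.closedBall x (1 / c) ⊆ Ω →
      ∫ y, u y * (n * profile (c ^ 2 * ‖y - x‖ ^ 2) +
        2 * (c ^ 2 * ‖y - x‖ ^ 2) * deriv profile (c ^ 2 * ‖y - x‖ ^ 2)) = 0)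
    {x : EuclideanSpace ℝ (Fin n)} {r a b : ℝ} (hr : 0 < r) (hx : Metric.closedBall x r ⊆ Ω)
    (ha : 1 / r < a) (hb : 1 / r < b) : radialAverage u x a = radialAverage u x b := by
  have hr' : (0 : ℝ) < 1 / r := by positivity
  have hd : ∀ c ∈ Ioi (1 / r), HasDerivAt (radialAverage u x) 0 c := by
    intro c hc
    have hc0 : 0 < c := hr'.trans hc
    have := hasDerivAt_radialAverage hn hu_int hr' hc (x := x) (by rwa [one_div_one_div])
    rwa [hw x c hc0, mul_zero] at this
    refine (Metric.closedBall_subset_closedBall ?_).trans hx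
    rw [div_le_comm₀ hc0 hr]
    exact (le_of_lt hc)
  exact isOpen_Ioi.is_const_of_deriv_eq_zero isPreconnected_Ioi
    (fun c hc => (hd c hc).differentiableAt.differentiableWithinAt) (fun c hc => (hd c hc).deriv)
    ha hb

/-- The total mass of the radial kernel. -/
noncomputable def profileMass (n : ℕ) : ℝ :=
  ∫ z : EuclideanSpace ℝ (Fin n), profile (‖z‖ ^ 2)

theorem profile_norm_sq_eq_zero {z : EuclideanSpace ℝ (Fin n)} (hz : 1 ≤ ‖z‖) :
    profile (‖z‖ ^ 2) = 0 := profile_eq_zero (one_le_pow₀ hz)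

theorem profileMass_pos (n : ℕ) : 0 < profileMass n := by
  have cp := continuous_profile
  refine Continuous.integral_pos_of_hasCompactSupport_nonneg_nonzero (x := 0) (by fun_prop) ?_
    (fun z => profile_nonneg _) ?_
  · refine HasCompactSupport.of_support_subset_isCompact (isCompact_closedBall 0 1) fun z hz => ?_
    rw [mem_closedBall_zero_iff]
    by_contra! h
    exact hz (profile_norm_sq_eq_zero h.le)
  · simp [profile, (expNegInvGlue.pos_of_pos one_pos).ne']

/-- The normalised kernels form an approximate identity; `u` is cut off to a ball because it is only
locally integrable. -/
theorem tendsto_radialAverage {Ω : Set (EuclideanSpace ℝ (Fin n))}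
    {u : EuclideanSpace ℝ (Fin n) → ℝ} (hu_int : LocallyIntegrableOn u Ω volume)
    {x : EuclideanSpace ℝ (Fin n)} {r : ℝ} (hr : 0 < r) (hx : Metric.closedBall x r ⊆ Ω)
    (hux : ContinuousAt u x) :
    Tendsto (radialAverage u x) atTop (𝓝 (profileMass n * u x)) := by
  have hm := profileMass_pos n
  have hK : IsCompact (Metric.closedBall x r) := isCompact_closedBall _ _
  have hev : (Metric.closedBall x r).indicator u =ᶠ[𝓝 x] u := by
    filter_upwards [Metric.closedBall_mem_nhds x hr] with y hy using indicator_of_mem hy u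
  have h := tendsto_integral_comp_smul_smul_of_integrable' (μ := volume)
    (φ := fun z : EuclideanSpace ℝ (Fin n) => (profileMass n)⁻¹ * profile (‖z‖ ^ 2))
    (fun z => mul_nonneg (inv_nonneg.2 hm.le) (profile_nonneg _))
    (by rw [integral_const_mul]; exact inv_mul_cancel₀ hm.ne')
    (by
      refine tendsto_const_nhds.congr' ?_
      filter_upwards [tendsto_norm_cobounded_atTop.eventually_ge_atTop 1] with z hz
      rw [profile_norm_sq_eq_zero hz]; simp)
    (g := (Metric.closedBall x r).indicator u) (x₀ := x)
    ((integrable_indicator_iff hK.measurableSet).2 (hu_int.integrableOn_compact_subset hx hK))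
    (hux.congr hev.symm)
  rw [hev.self_of_nhds] at h
  refine (h.const_mul (profileMass n)).congr' ?_
  filter_upwards [eventually_gt_atTop (1 / r)] with c hc
  have hc0 : 0 < c := (by positivity : 0 < 1 / r).trans hc
  rw [radialAverage, ← integral_const_mul]
  refine integral_congr_ae (Eventually.of_forall fun y => ?_)
  have hsq : ‖c • (x - y)‖ ^ 2 = c ^ 2 * ‖y - x‖ ^ 2 := by
    rw [norm_smul, mul_pow, Real.norm_eq_abs, sq_abs, norm_sub_rev]
  simp only [hsq, finrank_euclideanSpace, Fintype.card_fin, smul_eq_mul]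
  by_cases hy : y ∈ Metric.closedBall x r
  · rw [indicator_of_mem hy]
    field_simp
  · have : 1 ≤ c ^ 2 * ‖y - x‖ ^ 2 := one_le_sq_mul_of_notMem_closedBall hc0 fun h =>
      hy (Metric.closedBall_subset_closedBall (by rw [div_le_comm₀ hc0 hr]; exact hc.le) h)
    rw [profile_eq_zero this]; simp

/-- At fixed scale this is a convolution with a smooth compactly supported kernel. Since `1 / c <
r`, kernels centred within `r` of `x` do not see the cutoff of `u` at radius `2 * r`. -/
theorem contDiffAt_radialAverage {Ω : Set (EuclideanSpace ℝ (Fin n))}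
    {u : EuclideanSpace ℝ (Fin n) → ℝ} (hu_int : LocallyIntegrableOn u Ω volume)
    {x : EuclideanSpace ℝ (Fin n)} {r c : ℝ} (hr : 0 < r)
    (hx : Metric.closedBall x (2 * r) ⊆ Ω) (hc : 1 / r < c) {m : ℕ∞} :
    ContDiffAt ℝ m (fun y => radialAverage u y c) x := by
  have hc0 : 0 < c := (by positivity : 0 < 1 / r).trans hc
  have hK : IsCompact (Metric.closedBall x (2 * r)) := isCompact_closedBall _ _
  let η : EuclideanSpace ℝ (Fin n) → ℝ := fun z => c ^ n * profile (c ^ 2 * ‖z‖ ^ 2)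
  have hη : ContDiff ℝ m η :=
    contDiff_const.mul (contDiff_profile.comp (contDiff_const.mul (contDiff_norm_sq ℝ)))
  have hη0 : ∀ z, 1 / c < ‖z‖ → η z = 0 := by
    intro z hz
    have := one_le_sq_mul_of_notMem_closedBall hc0 (x := 0) (y := z)
      (by rw [mem_closedBall_zero_iff]; exact not_le.2 hz)
    rw [sub_zero] at this
    simp [η, profile_eq_zero this]
  have hηc : HasCompactSupport η := by
    refine HasCompactSupport.of_support_subset_isCompact (isCompact_closedBall 0 (1 / c))
      fun z hz => ?_
    rw [mem_closedBall_zero_iff]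
    by_contra! h
    exact hz (hη0 z h)
  have hg : LocallyIntegrable ((Metric.closedBall x (2 * r)).indicator u) volume :=
    ((integrable_indicator_iff hK.measurableSet).2
      (hu_int.integrableOn_compact_subset hx hK)).locallyIntegrable
  have hconv := hηc.contDiff_convolution_right (ContinuousLinearMap.mul ℝ ℝ) hg hη
  refine hconv.contDiffAt.congr_of_eventuallyEq ?_
  filter_upwards [Metric.ball_mem_nhds x hr] with y hy
  rw [radialAverage, convolution]
  refine integral_congr_ae (Eventually.of_forall fun t => ?_)
  simp only [ContinuousLinearMap.mul_apply']
  by_cases ht : t ∈ Metric.closedBall x (2 * r)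
  · rw [indicator_of_mem ht, norm_sub_rev]
  · have h1 : η (y - t) = 0 := by
      refine hη0 _ ?_
      rw [← dist_eq_norm]
      rw [Metric.mem_closedBall, not_le] at ht
      rw [Metric.mem_ball] at hy
      have h2 := dist_triangle t y x
      rw [dist_comm t y] at h2
      have : 1 / c < r := by rw [div_lt_comm₀ hc0 hr]; exact hc
      linarith
    rw [h1, mul_zero, norm_sub_rev]
    exact mul_eq_zero_of_right _ h1

/-! ### Weyl's lemma and the extension -/

/-- A weakly harmonic, locally integrable function agrees at its points of continuity with a
`C²` function. -/
theorem exists_contDiffAt_eq_of_weaklyHarmonic (hn : n ≠ 0) {Ω : Set (EuclideanSpace ℝ (Fin n))}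
    (hΩ : IsOpen Ω) {u : EuclideanSpace ℝ (Fin n) → ℝ}
    (hu_int : LocallyIntegrableOn u Ω volume)
    (hw : ∀ x c, 0 < c → Metric.closedBall x (1 / c) ⊆ Ω →
      ∫ y, u y * (n * profile (c ^ 2 * ‖y - x‖ ^ 2) +
        2 * (c ^ 2 * ‖y - x‖ ^ 2) * deriv profile (c ^ 2 * ‖y - x‖ ^ 2)) = 0) :
    ∃ U : EuclideanSpace ℝ (Fin n) → ℝ, (∀ x ∈ Ω, ContDiffAt ℝ 2 U x) ∧
      ∀ x ∈ Ω, ContinuousAt u x → U x = u x := by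
  have hm := profileMass_pos n
  have hball : ∀ x : EuclideanSpace ℝ (Fin n), ∃ r, 0 < r ∧
      (x ∈ Ω → Metric.closedBall x (2 * r) ⊆ Ω) := by
    intro x
    by_cases hx : x ∈ Ω
    · obtain ⟨ε, hε, h⟩ := Metric.nhds_basis_closedBall.mem_iff.1 (hΩ.mem_nhds hx)
      exact ⟨ε / 2, by positivity, fun _ => by rwa [mul_div_cancel₀ ε two_ne_zero]⟩
    · exact ⟨1, one_pos, fun h => absurd h hx⟩
  choose r hr hrΩ using hball
  have hlt : ∀ x, 1 / r x < 2 / r x := fun x => div_lt_div_of_pos_right one_lt_two (hr x)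
  have hsub : ∀ x ∈ Ω, Metric.closedBall x (r x) ⊆ Ω := fun x hx =>
    (Metric.closedBall_subset_closedBall (by linarith [hr x])).trans (hrΩ x hx)
  refine ⟨fun x => (profileMass n)⁻¹ * radialAverage u x (2 / r x), fun x hx => ?_,
    fun x hx hux => ?_⟩
  · have h := contDiffAt_radialAverage hu_int (hr x) (hrΩ x hx) (hlt x) (m := 2)
    refine ((contDiffAt_const (c := (profileMass n)⁻¹)).mul h).congr_of_eventuallyEq ?_
    filter_upwards [Metric.ball_mem_nhds x (hr x)] with y hy
    have hyx : Metric.closedBall y (r x) ⊆ Ω := by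
      refine (Metric.closedBall_subset_closedBall' ?_).trans (hrΩ x hx)
      linarith [Metric.mem_ball.1 hy]
    have hyΩ : y ∈ Ω := hyx (Metric.mem_closedBall_self (hr x).le)
    -- The radius `r y` may vary wildly with `y`. Both scales are compared with their maximum, so
    -- near `x` the fixed scale `2 / r x` may be used.
    have e1 := radialAverage_eq hn hu_int hw (hr y) (hsub y hyΩ) (hlt y)
      (b := max (2 / r y) (2 / r x)) ((hlt y).trans_le (le_max_left _ _))
    have e2 := radialAverage_eq hn hu_int hw (hr x) hyx (hlt x)
      (b := max (2 / r y) (2 / r x)) ((hlt x).trans_le (le_max_right _ _))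
    rw [e1, e2]
  · have h := tendsto_radialAverage hu_int (hr x) (hsub x hx) hux
    have hconst : radialAverage u x =ᶠ[atTop] fun _ => radialAverage u x (2 / r x) := by
      filter_upwards [eventually_gt_atTop (1 / r x)] with c hc
      exact radialAverage_eq hn hu_int hw (hr x) (hsub x hx) hc (hlt x)
    have := tendsto_nhds_unique (tendsto_const_nhds.congr' hconst.symm) h
    simp only [this, inv_mul_cancel_left₀ hm.ne']

theorem continuousAt_laplacian {U : EuclideanSpace ℝ (Fin n) → ℝ} {x : EuclideanSpace ℝ (Fin n)}
    (hU : ContDiffAt ℝ 2 U x) : ContinuousAt (Laplacian.laplacian U) x := by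
  rw [InnerProductSpace.laplacian_eq_iteratedFDeriv_orthonormalBasis U
    (EuclideanSpace.basisFun (Fin n) ℝ)]
  have h : ContinuousAt (iteratedFDeriv ℝ 2 U) x :=
    (hU.iteratedFDeriv_right (m := 0) (i := 2) (by norm_num)).continuousAt
  exact tendsto_finsetSum _ fun j _ =>
    ((ContinuousMultilinearMap.apply ℝ (fun _ : Fin 2 => EuclideanSpace ℝ (Fin n)) ℝ
      _).continuous.continuousAt.comp h)

theorem harmonicOnNhd_of_eqOn_dense {Ω W : Set (EuclideanSpace ℝ (Fin n))} (hΩ : IsOpen Ω)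
    (hW : IsOpen W) (hWd : Ω ⊆ closure W) {u U : EuclideanSpace ℝ (Fin n) → ℝ}
    (hu : InnerProductSpace.HarmonicOnNhd u W) (hU : ∀ x ∈ Ω, ContDiffAt ℝ 2 U x)
    (h : EqOn U u W) : InnerProductSpace.HarmonicOnNhd U Ω := by
  have hzero : ∀ x ∈ Ω, Laplacian.laplacian U x = 0 := by
    intro x hx
    have : (𝓝[W] x).NeBot := mem_closure_iff_nhdsWithin_neBot.1 (hWd hx)
    refine tendsto_nhds_unique
      ((continuousAt_laplacian (hU x hx)).tendsto.mono_left (nhdsWithin_le_nhds (s := W))) ?_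
    refine tendsto_const_nhds.congr' ?_
    filter_upwards [self_mem_nhdsWithin] with y hy
    have hev : U =ᶠ[𝓝 y] u := by filter_upwards [hW.mem_nhds hy] with z hz using h hz
    rw [(InnerProductSpace.laplacian_congr_nhds hev).self_of_nhds, (hu y hy).2.self_of_nhds]
    rfl
  exact fun x hx => ⟨hU x hx, by filter_upwards [hΩ.mem_nhds hx] with y hy using hzero y hy⟩

end HarmonicExtension

theorem theorem3 (n : ℕ) (hn : 2 ≤ n) (Ω E : Set (EuclideanSpace ℝ (Fin n)))
    (hΩ_open : IsOpen Ω) (hΩ_conn : IsConnected Ω)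
    (hE_sub : E ⊆ Ω) (hE_closed : IsClosed ((fun x : Ω => (x : EuclideanSpace ℝ (Fin n))) ⁻¹' E))
    (hE_fin : Measure.hausdorffMeasure ((n : ℝ) - 1) E < ⊤)
    (u : EuclideanSpace ℝ (Fin n) → ℝ)
    (hu : InnerProductSpace.HarmonicOnNhd u (Ω \ E))
    (hu_int : LocallyIntegrableOn u Ω volume)
    (hu_int2 : ∀ j : Fin n, LocallyIntegrableOn
      (HarmonicExtension.partialDeriv j (HarmonicExtension.partialDeriv j u)) Ω volume)
    (hu_match : ∀ j : Fin n,
      ∀ᵐ X : EuclideanSpace ℝ {i : Fin n // i ≠ j} ∂(Measure.hausdorffMeasure ((n : ℝ) - 1)),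
        (HarmonicExtension.lineSection E j X).Finite →
          ∀ t ∈ HarmonicExtension.lineSection E j X, HarmonicExtension.MatchesAt Ω E u j X t) :
    ∃ U : EuclideanSpace ℝ (Fin n) → ℝ,
      InnerProductSpace.HarmonicOnNhd U Ω ∧ EqOn U u (Ω \ E) ∧
      ∀ V : EuclideanSpace ℝ (Fin n) → ℝ,
        InnerProductSpace.HarmonicOnNhd V Ω → EqOn V u (Ω \ E) → EqOn V U Ω := by
  have hn1 : (1 : ℝ) ≤ n := by exact_mod_cast (one_le_two.trans hn)
  have hE0 : volume E = 0 :=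
    HarmonicExtension.volume_eq_zero_of_hausdorffMeasure_lt_top (by linarith) hE_fin
  have hcard : ∀ j : Fin n, (n : ℝ) - 1 = Fintype.card {i : Fin n // i ≠ j} := by
    intro j
    simp [Nat.cast_sub (one_le_two.trans hn)]
  have hfin := fun j =>
    HarmonicExtension.ae_finite_lineSection (sub_nonneg.2 hn1) hE_fin j
  have hmatch : ∀ j, ∀ᵐ X : EuclideanSpace ℝ {i : Fin n // i ≠ j},
      ∀ t ∈ HarmonicExtension.lineSection E j X, HarmonicExtension.MatchesAt Ω E u j X t :=
    fun j => HarmonicExtension.ae_volume_of_ae_hausdorffMeasure (hcard j)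
      (by filter_upwards [hfin j, hu_match j] with X h1 h2 using h2 h1)
  have hW : IsOpen (Ω \ E) := by
    have := hΩ_open.isOpenMap_subtype_val _ hE_closed.isOpen_compl
    convert this using 1
    ext x
    simp
  have hWd : Ω ⊆ closure (Ω \ E) := by
    intro x hx
    rw [mem_closure_iff]
    intro o ho hxo
    -- A nonempty open set has positive measure, so the null set `E` cannot contain it.
    have hpos : 0 < volume (o ∩ Ω) := (ho.inter hΩ_open).measure_pos volume ⟨x, hxo, hx⟩
    by_contra hemp
    refine hpos.ne' (measure_mono_null (fun y hy => ?_) hE0)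
    by_contra hyE
    exact hemp ⟨y, hy.1, hy.2, hyE⟩
  obtain ⟨U, hU, hUu⟩ := HarmonicExtension.exists_contDiffAt_eq_of_weaklyHarmonic
    (by lia) hΩ_open hu_int
    fun x c hc hx => HarmonicExtension.integral_mul_laplacian_radial_eq_zero hΩ_open hu hE0 hu_int
      hu_int2 (fun j => HarmonicExtension.ae_volume_of_ae_hausdorffMeasure (hcard j) (hfin j))
      hmatch hc hx
  have hEq : EqOn U u (Ω \ E) := fun x hx => hUu x hx.1 (hu x hx).1.continuousAt
  refine ⟨U, HarmonicExtension.harmonicOnNhd_of_eqOn_dense hΩ_open hW hWd hu hU hEq, hEq,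
    fun V hV hVu x hx => ?_⟩
  have : (𝓝[Ω \ E] x).NeBot := mem_closure_iff_nhdsWithin_neBot.1 (hWd hx)
  refine tendsto_nhds_unique_of_eventuallyEq (l := 𝓝[Ω \ E] x)
    ((hV x hx).1.continuousAt.tendsto.mono_left nhdsWithin_le_nhds)
    ((hU x hx).continuousAt.tendsto.mono_left nhdsWithin_le_nhds) ?_
  filter_upwards [self_mem_nhdsWithin] with y hy using (hVu hy).trans (hEq hy).symm
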